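/- **Setting.** Let $d_0,\dots,d_M$ be layer widths and $\sigma:\mathbb R\to\mathbb R$ a continuous activation function. A weight vector $v=[W_m,b_m]_{m=1}^M\in\mathcal V=\bigoplus_{m=1}^M(\mathbb R^{d_m\times d_{m-1}}\oplus\mathbb R^{d_m})$ defines an MLP with activations $x_0=x$, $x_{m}=\sigma(W_{m}x_{m-1}+b_{m})$; write $x_m(v,x)$ for these. Let $\Pi_d$ be the set of $d\times d$ permutation matrices and $G=\Pi_{d_1}\times\cdots\times\Pi_{d_{M-1}}$, where $(P_1,\dots,P_{M-1})\in G$ acts on $\mathcal V$ by $W_m\mapsto P_mW_mP_{m-1}^T$, $b_m\mapsto P_mb_m$, with the convention $P_0=I$, $P_M=I$. Let $\langle\cdot,\cdot\rangle$ be the Frobenius inner product of matrices. **Activation Matching.** Given inputs $x_1,\dots,x_N\in\mathbb R^{d_0}$ and $v,v'\in\mathcal V$, the cost matrices are $Z_m=\sum_{l=1}^N x_m(v,x_l)\,x_m(v',x_l)^T\in\mathbb R^{d_m\times d_m}$, $m=1,\dots,M-1$, and the solutions are the $(P_1,\dots,P_{M-1})\in G$ such that each $P_m$ maximizes $\langle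 Z_m,P\rangle$ over $P\in\Pi_{d_m}$. A matrix $Z\in\mathbb R^{d\times d}$ is *$\epsilon$-friendly* if there is $P\in\Pi_d$ with $\langle Z,P\rangle>\langle Z,P'\rangle+\epsilon$ for all $P'\in\Pi_d$, $P'\ne P$. **Architecture.** An instance is given by numbers of feature channels $c_0=1,c_1,\dots,c_r$ ($r\ge1$) and a choice of the function $\phi$ below. A DWS network is $\mathcal E=L_r\circ\mathrm{ReLU}\circ L_{r-1}\circ\cdots\circ\mathrm{ReLU}\circ L_1$, where each $L_i:\mathcal V^{c_{i-1}}\to\mathcal V^{c_i}$ is an affine map that is equivariant under $G$ (acting on each channel) and ReLU is applied entrywise. For neuron $i$ of layer $m$ let $a_{m,i}(v)\in\mathbb R^{c_r}$ collect the $i$-th entries of the $m$-th bias vectors of the $c_r$ channels of $\mathcal E(v)$. Let $Q_m\in\mathbb R^{d_m\times d_m}$ have the entries $(Q_m)_{i,j}=\phi(a_{m,i}(v),a_{m,j}(v'))$, where either $\phi(a,b)=\langle a,b\rangle$ or $\phi(a,b)=s^2\langle a/\|a\|_2,b/\|b\|_2\rangle$ (with $0/\|0\|_2:=0$) for a scalar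 $s$. The output is $F(v,v';\theta)=(P_1,\dots,P_{M-1})$ with $P_m\in\operatorname{argmax}_{P\in\Pi_{d_m}}\langle Q_m,P\rangle$. The weights $\theta$ are the maps $L_1,\dots,L_r$ and $s$. **Proposition.** For every compact set $K\subset\mathcal V$, all $x_1,\dots,x_N\in\mathbb R^{d_0}$, every $\epsilon>0$ and each of the two choices of $\phi$, there are an instance of the architecture $F$ with this $\phi$ and weights $\theta$ for it such that for all $v,v'\in K$ for which all cost matrices $Z_1,\dots,Z_{M-1}$ of Activation Matching are $\epsilon$-friendly, Activation Matching has exactly one solution $g\in G$, and $F(v,v';\theta)$ returns exactly $g$ (each maximizer in the last layer of $F$ is unique, so no tie-breaking rule matters). -/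

import Mathlib

open scoped Matrix

noncomputable section

namespace DeepAlign

variable {M : ℕ}

/-- The weight space `⊕_{m=1}^M (ℝ^{d_m × d_{m-1}} ⊕ ℝ^{d_m})` of `M`-layer MLPs with layer
widths `d 0, …, d M`.  The component at `k : Fin M` is the pair `(W_{k+1}, b_{k+1})`. -/
abbrev WeightSpace (d : Fin (M + 1) → ℕ) : Type :=
  (k : Fin M) → Matrix (Fin (d k.succ)) (Fin (d k.castSucc)) ℝ × (Fin (d k.succ) → ℝ)

/-- The activations of the MLP with weights `v` on the input `x`:
`x_0 = x`, `x_{m+1} = σ (W_{m+1} x_m + b_{m+1})`, with `σ` applied entrywise. -/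
def activation (σ : ℝ → ℝ) {d : Fin (M + 1) → ℕ} (v : WeightSpace d) (x : Fin (d 0) → ℝ)
    (m : Fin (M + 1)) : Fin (d m) → ℝ :=
  Fin.induction (motive := fun m => Fin (d m) → ℝ) x
    (fun k xk => fun i => σ (((v k).1 *ᵥ xk + (v k).2) i)) m

/-! ### Permutation matrices and the symmetry group -/

/-- `P` is an `n × n` permutation matrix. -/
def IsPermMatrix {n : ℕ} (P : Matrix (Fin n) (Fin n) ℝ) : Prop :=
  ∃ π : Equiv.Perm (Fin n), P = π.permMatrix ℝ

/-- The symmetry group `Π_{d_1} × ⋯ × Π_{d_{M-1}}`: sequences of permutation matrices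
`(P_1, …, P_{M-1})`, one for each hidden layer.  The conventions `P_0 = 1` and `P_M = 1` (the input
and output layers are not permuted) are built into the indexing. -/
def symmetryGroup (d : Fin (M + 1) → ℕ) :
    Set ((m : Fin (M + 1)) → Matrix (Fin (d m)) (Fin (d m)) ℝ) :=
  {P | (∀ m, IsPermMatrix (P m)) ∧ P 0 = 1 ∧ P (Fin.last M) = 1}

/-- The action on weights: `W_m' = P_m W_m P_{m-1}ᵀ` and `b_m' = P_m b_m`. -/
def act {d : Fin (M + 1) → ℕ} (P : (m : Fin (M + 1)) → Matrix (Fin (d m)) (Fin (d m)) ℝ)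
    (v : WeightSpace d) : WeightSpace d :=
  fun k => (P k.succ * (v k).1 * (P k.castSucc)ᵀ, P k.succ *ᵥ (v k).2)

/-! ### The linear assignment problem -/

/-- The Frobenius inner product of two square matrices. -/
def frob {n : ℕ} (A B : Matrix (Fin n) (Fin n) ℝ) : ℝ :=
  ∑ i, ∑ j, A i j * B i j

/-- `P` is an optimal solution of the linear assignment problem with cost matrix `Q`, that is,
`P` maximises `⟨Q, P⟩` over all permutation matrices. -/
def IsOptimalAssignment {n : ℕ} (Q P : Matrix (Fin n) (Fin n) ℝ) : Prop :=
  IsPermMatrix P ∧ ∀ R, IsPermMatrix R → frob Q R ≤ frob Q P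

/-- `Z` is `ε`-friendly: some permutation matrix beats every other one by more than `ε`. -/
def IsFriendly {n : ℕ} (ε : ℝ) (Z : Matrix (Fin n) (Fin n) ℝ) : Prop :=
  ∃ P, IsPermMatrix P ∧ ∀ R, IsPermMatrix R → R ≠ P → frob Z R + ε < frob Z P

/-- All sequences in the symmetry group that solve the linear assignment problem of every hidden
layer `m = 1, …, M-1` for a sequence `Q_1, …, Q_M` of square matrices (`Q_{k+1}` is at `k`; the
matrix `Q_M` of the output layer is not used).  Where the optima are not unique, all of them are
listed, so the set is a singleton exactly if there is no tie. -/
def assignments {d : Fin (M + 1) → ℕ}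
    (Q : (k : Fin M) → Matrix (Fin (d k.succ)) (Fin (d k.succ)) ℝ) :
    Set ((m : Fin (M + 1)) → Matrix (Fin (d m)) (Fin (d m)) ℝ) :=
  {P | P ∈ symmetryGroup d ∧
    ∀ k : Fin M, k.succ ≠ Fin.last M → IsOptimalAssignment (Q k) (P k.succ)}

/-! ### Activation matching -/

/-- The cost matrix of layer `k + 1` in activation matching: the outer product
`Z = ∑_l x_{k+1}(v, x_l) x_{k+1}(v', x_l)ᵀ` of the activations of both networks. -/
def costMatrix (σ : ℝ → ℝ) {d : Fin (M + 1) → ℕ} {N : ℕ} (x : Fin N → Fin (d 0) → ℝ)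
    (v v' : WeightSpace d) (k : Fin M) : Matrix (Fin (d k.succ)) (Fin (d k.succ)) ℝ :=
  Matrix.of fun i j =>
    ∑ l, activation σ v (x l) k.succ i * activation σ v' (x l) k.succ j

/-- The optimal solutions of the activation matching algorithm. -/
def activationMatching (σ : ℝ → ℝ) {d : Fin (M + 1) → ℕ} {N : ℕ} (x : Fin N → Fin (d 0) → ℝ)
    (v v' : WeightSpace d) : Set ((m : Fin (M + 1)) → Matrix (Fin (d m)) (Fin (d m)) ℝ) :=
  assignments (costMatrix σ x v v')

/-! ### The architecture -/

/-- An affine layer `𝒱^c → 𝒱^{c'}` of a DWS network: an affine map that is equivariant under the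
symmetry group, which acts on each feature channel. -/
structure DWSLayer (d : Fin (M + 1) → ℕ) (c c' : ℕ) where
  toAffine : (Fin c → WeightSpace d) →ᵃ[ℝ] (Fin c' → WeightSpace d)
  equivariant : ∀ P ∈ symmetryGroup d, ∀ u : Fin c → WeightSpace d,
    toAffine (fun a => act P (u a)) = fun a => act P (toAffine u a)

/-- The entrywise ReLU on `𝒱^c`. -/
def relu {d : Fin (M + 1) → ℕ} {c : ℕ} (u : Fin c → WeightSpace d) : Fin c → WeightSpace d :=
  fun a k => ((u a k).1.map fun t => max t 0, fun i => max ((u a k).2 i) 0)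

/-- The weights of a DWS network with input channels `c`, a list of hidden channel numbers, and
`out` output channels: one equivariant affine layer for each step. -/
def DWSWeights (d : Fin (M + 1) → ℕ) (out : ℕ) : ℕ → List ℕ → Type
  | c, [] => DWSLayer d c out
  | c, h :: t => DWSLayer d c h × DWSWeights d out h t

/-- The DWS network `L_r ∘ ReLU ∘ L_{r-1} ∘ ⋯ ∘ ReLU ∘ L_1`. -/
def dwsNet {d : Fin (M + 1) → ℕ} {out : ℕ} : (c : ℕ) → (hidden : List ℕ) →
    DWSWeights d out c hidden → (Fin c → WeightSpace d) → (Fin out → WeightSpace d)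
  | _, [], L, u => DWSLayer.toAffine L u
  | _, h :: t, L, u => dwsNet h t L.2 (relu (DWSLayer.toAffine L.1 u))

/-- The map `𝒱^c → 𝒜^c` that keeps the biases: the feature vector in `ℝ^c` at neuron `i` of layer
`k + 1`. -/
def toActivationSpace {d : Fin (M + 1) → ℕ} {c : ℕ} (u : Fin c → WeightSpace d) (k : Fin M)
    (i : Fin (d k.succ)) : EuclideanSpace ℝ (Fin c) :=
  WithLp.toLp 2 fun a => (u a k).2 i

/-- The two versions of the generalized outer product layer. -/
inductive ProductKind
  /-- `φ(a, b) = ⟨a, b⟩`, the ordinary outer product. -/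
  | plain
  /-- `φ(a, b) = s² ⟨a / ‖a‖, b / ‖b‖⟩`. -/
  | normalized

/-- The symmetric function `φ` of the generalized outer product layer, with scaling factor `s`
(not used by the plain version). -/
def phi (κ : ProductKind) (s : ℝ) {c : ℕ} (a b : EuclideanSpace ℝ (Fin c)) : ℝ :=
  match κ with
  | .plain => inner ℝ a b
  | .normalized => s ^ 2 * inner ℝ (‖a‖⁻¹ • a) (‖b‖⁻¹ • b)

/-- An instance of the architecture: the kind of product layer, the number of feature channels of
each hidden layer of the DWS network, and the number of its output channels. -/
structure Architecture where
  kind : ProductKind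
  hidden : List ℕ
  out : ℕ

/-- The weights `θ` for an instance of the architecture. -/
structure Weights (d : Fin (M + 1) → ℕ) (A : Architecture) where
  encoder : DWSWeights d A.out 1 A.hidden
  scale : ℝ

/-- The Siamese encoder followed by the map to the activation space: the same function is applied
to both inputs. -/
def features {d : Fin (M + 1) → ℕ} {A : Architecture} (θ : Weights d A) (v : WeightSpace d)
    (k : Fin M) (i : Fin (d k.succ)) : EuclideanSpace ℝ (Fin A.out) :=
  toActivationSpace (dwsNet 1 A.hidden θ.encoder fun _ => v) k i

/-- The matrices `Q_1, …, Q_M` after the generalized outer product layer. -/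
def productLayer {d : Fin (M + 1) → ℕ} {A : Architecture} (θ : Weights d A)
    (v v' : WeightSpace d) (k : Fin M) : Matrix (Fin (d k.succ)) (Fin (d k.succ)) ℝ :=
  Matrix.of fun i j => phi A.kind θ.scale (features θ v k i) (features θ v' k j)

/-- The possible outputs `F(v, v'; θ)`: the projection layer picks, for each hidden layer, a
permutation matrix of highest correlation with `Q_m`.  Outputs for all ways to break ties are
listed, so that `F θ v v' = {g}` says that the network returns `g` however ties are broken. -/
def F {d : Fin (M + 1) → ℕ} {A : Architecture} (θ : Weights d A) (v v' : WeightSpace d) :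
    Set ((m : Fin (M + 1)) → Matrix (Fin (d m)) (Fin (d m)) ℝ) :=
  assignments (productLayer θ v v')

end DeepAlign

end

noncomputable section

namespace DeepAlign

variable {M : ℕ}

/-! The projection onto permutation matrices is discrete, so an `ε`-friendly assignment problem
keeps its solution when the cost matrix is perturbed slightly. It therefore suffices that the
encoder approximates, uniformly on `K`, all activations on the `N` inputs, one output channel per
input: the inner product of two feature vectors is then close to an entry of the cost matrix.

The approximation takes place in `C(K, WeightSpace d)`. The closure of the functions built from
equivariant affine maps, sums and ReLUs is stable under every continuous entrywise map, by the
lattice form of Stone–Weierstrass, and hence under entrywise products, by polarization. A forward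
step copies the previous activations along the rows of the weight matrices, multiplies entrywise by
the weights, sums each row, adds the bias and applies `σ` (`exists_forward_step`). `M` rounds
produce all activations. The input can be injected as a constant because the group fixes the input
layer.

For the normalized product, an extra channel with a large constant `C` makes the norms nearly
constant. With scale `C`, what remains besides a small error depends on one argument only
(`exists_phi_approx`); such row and column terms do not affect an assignment problem
(`frob_lt_frob_of_approx`). -/

/-- Apply a scalar function to all entries of all weights. -/
def entrywise (φ : ℝ → ℝ) {d : Fin (M + 1) → ℕ} (u : WeightSpace d) : WeightSpace d :=
  fun k => ((u k).1.map φ, fun i => φ ((u k).2 i))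

/-! ### The group action as a permutation of indices -/

/-- Elements of the symmetry group act by permuting indices. -/
theorem exists_perm_act {d : Fin (M + 1) → ℕ}
    {P : (m : Fin (M + 1)) → Matrix (Fin (d m)) (Fin (d m)) ℝ} (hP : P ∈ symmetryGroup d) :
    ∃ π : (m : Fin (M + 1)) → Equiv.Perm (Fin (d m)), π 0 = 1 ∧ ∀ (u : WeightSpace d) k,
      act P u k = (Matrix.of fun i j => (u k).1 (π k.succ i) (π k.castSucc j),
        fun i => (u k).2 (π k.succ i)) := by
  obtain ⟨h, h0, -⟩ := hP
  choose π hπ using h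
  -- `P 0 = 1` already forces the permutation at `0` to be trivial; overwriting it makes this
  -- immediate.
  have key : ∀ m, P m = (Function.update π 0 1 m).permMatrix ℝ := by
    intro m
    by_cases hm : m = 0
    · subst hm; simp [h0]
    · simp [Function.update_of_ne hm, hπ m]
  refine ⟨Function.update π 0 1, by simp, fun u k => ?_⟩
  simp only [act, key]
  refine Prod.ext ?_ ?_
  · ext i j
    simp [Matrix.mul_apply, PEquiv.toMatrix_apply, Equiv.toPEquiv_apply, Equiv.symm_apply_eq]
  · ext i
    simp [Matrix.mulVec, dotProduct, PEquiv.toMatrix_apply, Equiv.toPEquiv_apply]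

theorem entrywise_act (φ : ℝ → ℝ) {d : Fin (M + 1) → ℕ}
    {P : (m : Fin (M + 1)) → Matrix (Fin (d m)) (Fin (d m)) ℝ} (hP : P ∈ symmetryGroup d)
    (u : WeightSpace d) : entrywise φ (act P u) = act P (entrywise φ u) := by
  obtain ⟨π, -, h⟩ := exists_perm_act hP
  funext k
  simp only [entrywise, h]
  rfl

/-- `act P` as a linear map. -/
def actLinear {d : Fin (M + 1) → ℕ} (P : (m : Fin (M + 1)) → Matrix (Fin (d m)) (Fin (d m)) ℝ) :
    WeightSpace d →ₗ[ℝ] WeightSpace d where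
  toFun := act P
  map_add' u v := by
    funext k; simp [act, Matrix.mul_add, Matrix.add_mul, Matrix.mulVec_add]
  map_smul' r u := by
    funext k; simp [act, Matrix.mulVec_smul]

theorem act_add {d : Fin (M + 1) → ℕ} (P : (m : Fin (M + 1)) → Matrix (Fin (d m)) (Fin (d m)) ℝ)
    (u v : WeightSpace d) : act P (u + v) = act P u + act P v := (actLinear P).map_add u v

theorem act_sub {d : Fin (M + 1) → ℕ} (P : (m : Fin (M + 1)) → Matrix (Fin (d m)) (Fin (d m)) ℝ)
    (u v : WeightSpace d) : act P (u - v) = act P u - act P v := (actLinear P).map_sub u v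

theorem act_neg {d : Fin (M + 1) → ℕ} (P : (m : Fin (M + 1)) → Matrix (Fin (d m)) (Fin (d m)) ℝ)
    (u : WeightSpace d) : act P (-u) = -act P u := (actLinear P).map_neg u

theorem act_smul {d : Fin (M + 1) → ℕ} (P : (m : Fin (M + 1)) → Matrix (Fin (d m)) (Fin (d m)) ℝ)
    (r : ℝ) (u : WeightSpace d) : act P (r • u) = r • act P u := (actLinear P).map_smul r u

/-! ### Functions generated by equivariant affine maps and ReLU -/

/-- Functions of the weights that can be built from the identity with equivariant affine maps,
sums and entrywise ReLUs. -/
inductive Computable {d : Fin (M + 1) → ℕ} : (WeightSpace d → WeightSpace d) → Prop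
  | id : Computable fun v => v
  | affine (A : WeightSpace d →ᵃ[ℝ] WeightSpace d)
      (hA : ∀ P ∈ symmetryGroup d, ∀ u, A (act P u) = act P (A u))
      {f : WeightSpace d → WeightSpace d} (hf : Computable f) : Computable fun v => A (f v)
  | add {f g : WeightSpace d → WeightSpace d} (hf : Computable f) (hg : Computable g) :
      Computable fun v => f v + g v
  | relu {f : WeightSpace d → WeightSpace d} (hf : Computable f) :
      Computable fun v => entrywise (fun t => max t 0) (f v)

/-! ### Joint realization by a network -/

/-- `f` is the function of some network with one input channel. -/
def IsRealized {d : Fin (M + 1) → ℕ} {c : ℕ} (f : WeightSpace d → Fin c → WeightSpace d) : Prop :=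
  ∃ (hidden : List ℕ) (w : DWSWeights d c 1 hidden),
    ∀ v, dwsNet 1 hidden w (fun _ => v) = f v

/-- The layer whose output channels are given by a family of equivariant affine maps. -/
def DWSLayer.ofFamily {d : Fin (M + 1) → ℕ} {c c' : ℕ}
    (A : Fin c' → (Fin c → WeightSpace d) →ᵃ[ℝ] WeightSpace d)
    (hA : ∀ j, ∀ P ∈ symmetryGroup d, ∀ u, A j (fun a => act P (u a)) = act P (A j u)) :
    DWSLayer d c c' where
  toAffine := AffineMap.pi A
  equivariant P hP u := funext fun j => hA j P hP u

/-- The composition of two layers. -/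
def DWSLayer.comp {d : Fin (M + 1) → ℕ} {a b c : ℕ} (L : DWSLayer d b c) (L' : DWSLayer d a b) :
    DWSLayer d a c where
  toAffine := L.toAffine.comp L'.toAffine
  equivariant P hP u := by
    simp only [AffineMap.comp_apply, L'.equivariant P hP, L.equivariant P hP]

/-- No ReLU follows the last layer, so `L` merges into it and the hidden widths stay the same. With
a ReLU in between, the old output width becomes a new hidden width. -/
theorem exists_dwsNet_layer {d : Fin (M + 1) → ℕ} {b b' : ℕ} (L : DWSLayer d b b') :
    ∀ (hidden : List ℕ) (c : ℕ) (w : DWSWeights d b c hidden),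
      ∃ w' : DWSWeights d b' c hidden, ∀ u, dwsNet c hidden w' u = L.toAffine (dwsNet c hidden w u)
  | [], _, w => ⟨L.comp w, fun _ => rfl⟩
  | h :: t, _, w => by
    obtain ⟨w', hw'⟩ := exists_dwsNet_layer L t h w.2
    exact ⟨(w.1, w'), fun u => hw' _⟩

theorem exists_dwsNet_relu_layer {d : Fin (M + 1) → ℕ} {b b' : ℕ} (L : DWSLayer d b b') :
    ∀ (hidden : List ℕ) (c : ℕ) (w : DWSWeights d b c hidden),
      ∃ w' : DWSWeights d b' c (hidden ++ [b]),
        ∀ u, dwsNet c (hidden ++ [b]) w' u = L.toAffine (relu (dwsNet c hidden w u))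
  | [], _, w => ⟨(w, L), fun _ => rfl⟩
  | h :: t, _, w => by
    obtain ⟨w', hw'⟩ := exists_dwsNet_relu_layer L t h w.2
    exact ⟨(w.1, w'), fun u => hw' _⟩

theorem IsRealized.layer {d : Fin (M + 1) → ℕ} {c c' : ℕ}
    {f : WeightSpace d → Fin c → WeightSpace d} (hf : IsRealized f) (L : DWSLayer d c c') :
    IsRealized fun v => L.toAffine (f v) := by
  obtain ⟨hid, w, h⟩ := hf
  obtain ⟨w', h'⟩ := exists_dwsNet_layer L hid 1 w
  exact ⟨hid, w', fun v => by rw [h', h]⟩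

theorem IsRealized.relu_layer {d : Fin (M + 1) → ℕ} {c c' : ℕ}
    {f : WeightSpace d → Fin c → WeightSpace d} (hf : IsRealized f) (L : DWSLayer d c c') :
    IsRealized fun v => L.toAffine (relu (f v)) := by
  obtain ⟨hid, w, h⟩ := hf
  obtain ⟨w', h'⟩ := exists_dwsNet_relu_layer L hid 1 w
  exact ⟨_, w', fun v => by rw [h', h]⟩

theorem isRealized_id {d : Fin (M + 1) → ℕ} :
    IsRealized fun (v : WeightSpace d) (_ : Fin 1) => v :=
  ⟨[], ⟨AffineMap.id ℝ _, fun _ _ _ => rfl⟩, fun _ => rfl⟩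

/-- The projection to a channel, as an affine map. -/
def channel {d : Fin (M + 1) → ℕ} {c : ℕ} (j : Fin c) :
    (Fin c → WeightSpace d) →ᵃ[ℝ] WeightSpace d :=
  (LinearMap.proj j : (Fin c → WeightSpace d) →ₗ[ℝ] WeightSpace d).toAffineMap

@[simp] theorem channel_apply {d : Fin (M + 1) → ℕ} {c : ℕ} (j : Fin c)
    (u : Fin c → WeightSpace d) : channel j u = u j := rfl

theorem IsRealized.select {d : Fin (M + 1) → ℕ} {c c' : ℕ}
    {f : WeightSpace d → Fin c → WeightSpace d} (hf : IsRealized f) (e : Fin c' → Fin c) :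
    IsRealized fun v j => f v (e j) :=
  hf.layer (DWSLayer.ofFamily (fun j => channel (e j)) fun _ _ _ _ => rfl)

/-- Networks can compute an additional affine channel. -/
theorem IsRealized.snoc_affine {d : Fin (M + 1) → ℕ} {c : ℕ}
    {f : WeightSpace d → Fin c → WeightSpace d} (hf : IsRealized f)
    (A : (Fin c → WeightSpace d) →ᵃ[ℝ] WeightSpace d)
    (hA : ∀ P ∈ symmetryGroup d, ∀ u, A (fun a => act P (u a)) = act P (A u)) :
    IsRealized fun v => (Fin.snoc (f v) (A (f v)) : Fin (c + 1) → WeightSpace d) := by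
  convert hf.layer (DWSLayer.ofFamily (c' := c + 1) (Fin.snoc (fun j => channel j) A) ?_) using 2
    with v
  · funext j
    refine Fin.lastCases ?_ (fun j => ?_) j <;> simp [DWSLayer.ofFamily]
  · intro j P hP u
    refine Fin.lastCases ?_ (fun j => ?_) j
    · simpa using hA P hP u
    · simp

/-- Networks can apply ReLU to one channel and keep the others. -/
theorem IsRealized.snoc_relu {d : Fin (M + 1) → ℕ} {c : ℕ}
    {f : WeightSpace d → Fin c → WeightSpace d} (hf : IsRealized f) (j : Fin c) :
    IsRealized fun v => (Fin.snoc (f v) (entrywise (fun t => max t 0) (f v j)) :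
      Fin (c + 1) → WeightSpace d) := by
  -- ReLU hits every channel, so each value `t` is carried as the pair `t, -t` and recovered as `max
  -- t 0 - max (-t) 0`.
  have h1 := hf.layer (DWSLayer.ofFamily (c' := c + c)
    (Fin.append (fun j => channel j) (fun j => -channel j)) (by
      intro j P hP u
      refine Fin.addCases (fun j => ?_) (fun j => ?_) j
      · simp
      · simp [act_neg, -Fin.natAdd_eq_addNat]))
  convert h1.relu_layer (DWSLayer.ofFamily (c' := c + 1)
    (Fin.snoc (fun j => channel (Fin.castAdd c j) - channel (Fin.natAdd c j))
      (channel (Fin.castAdd c j))) ?_) using 2 with v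
  · funext i
    refine Fin.lastCases ?_ (fun i => ?_) i
    · funext k
      simp [DWSLayer.ofFamily, relu, entrywise]
    · simp only [Fin.snoc_castSucc, DWSLayer.ofFamily, AffineMap.pi_apply]
      funext k
      refine Prod.ext ?_ ?_
      · ext a b
        simp [relu, max_def, -Fin.natAdd_eq_addNat]; grind
      · ext a
        simp [relu, max_def, -Fin.natAdd_eq_addNat]; grind
  · intro i P hP u
    refine Fin.lastCases ?_ (fun i => ?_) i <;> simp [act_sub]

/-- A sum needs both summands in the same network, so the induction extends an arbitrary network
while preserving all its channels. One of these is the identity, from which every construction can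
start afresh. -/
theorem Computable.exists_extension {d : Fin (M + 1) → ℕ} {g : WeightSpace d → WeightSpace d}
    (hg : Computable g) : ∀ {c : ℕ} {f : WeightSpace d → Fin c → WeightSpace d}, IsRealized f →
      (∃ j, ∀ v, f v j = v) → ∃ (c' : ℕ) (f' : WeightSpace d → Fin c' → WeightSpace d),
        IsRealized f' ∧ (∀ i, ∃ j, ∀ v, f' v j = f v i) ∧ ∃ j, ∀ v, f' v j = g v := by
  induction hg with
  | id => exact fun {c f} hf h => ⟨c, f, hf, fun i => ⟨i, fun _ => rfl⟩, h⟩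
  | affine A hA _ ih =>
    intro c f hf h
    obtain ⟨c', f', hf', hext, j, hj⟩ := ih hf h
    refine ⟨_, _, hf'.snoc_affine (A.comp (channel j)) fun P hP u => hA P hP _, fun i => ?_,
      Fin.last _, fun v => by simp [hj]⟩
    obtain ⟨a, ha⟩ := hext i
    exact ⟨a.castSucc, fun v => by simp [ha]⟩
  | add _ _ ih₁ ih₂ =>
    intro c f hf h
    obtain ⟨c₁, f₁, hf₁, hext₁, j₁, hj₁⟩ := ih₁ hf h
    obtain ⟨c₂, f₂, hf₂, hext₂, j₂, hj₂⟩ := ih₂ hf₁ (by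
      obtain ⟨j, hj⟩ := h
      obtain ⟨a, ha⟩ := hext₁ j
      exact ⟨a, fun v => by rw [ha, hj]⟩)
    obtain ⟨a, ha⟩ := hext₂ j₁
    refine ⟨_, _, hf₂.snoc_affine (channel a + channel j₂) fun P hP u => by simp [act_add],
      fun i => ?_, Fin.last _, fun v => by simp [ha, hj₁, hj₂]⟩
    obtain ⟨b, hb⟩ := hext₁ i
    obtain ⟨b', hb'⟩ := hext₂ b
    exact ⟨b'.castSucc, fun v => by simp [hb, hb']⟩
  | relu _ ih =>
    intro c f hf h
    obtain ⟨c', f', hf', hext, j, hj⟩ := ih hf h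
    refine ⟨_, _, hf'.snoc_relu j, fun i => ?_, Fin.last _, fun v => by simp [hj]⟩
    obtain ⟨a, ha⟩ := hext i
    exact ⟨a.castSucc, fun v => by simp [ha]⟩

/-- Finitely many computable functions are the output channels of one network. -/
theorem isRealized_of_computable {d : Fin (M + 1) → ℕ} {n : ℕ}
    (h : Fin n → WeightSpace d → WeightSpace d) (hh : ∀ l, Computable (h l)) :
    IsRealized fun v l => h l v := by
  have key : ∃ (c : ℕ) (f : WeightSpace d → Fin c → WeightSpace d), IsRealized f ∧
      (∃ j, ∀ v, f v j = v) ∧ ∀ l, ∃ j, ∀ v, f v j = h l v := by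
    induction n with
    | zero => exact ⟨1, _, isRealized_id, ⟨0, fun _ => rfl⟩, fun l => l.elim0⟩
    | succ n ih =>
      obtain ⟨c, f, hf, ⟨j₀, hj₀⟩, hl⟩ := ih (fun l => h l.castSucc) fun l => hh _
      obtain ⟨c', f', hf', hext, hlast⟩ := (hh (Fin.last n)).exists_extension hf ⟨j₀, hj₀⟩
      refine ⟨c', f', hf', ?_, fun l => ?_⟩
      · obtain ⟨a, ha⟩ := hext j₀
        exact ⟨a, fun v => by rw [ha, hj₀]⟩
      · refine Fin.lastCases hlast (fun l => ?_) l
        obtain ⟨j, hj⟩ := hl l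
        obtain ⟨a, ha⟩ := hext j
        exact ⟨a, fun v => by rw [ha, hj]⟩
  obtain ⟨c, f, hf, -, hl⟩ := key
  choose e he using hl
  simpa only [he] using hf.select e

/-! ### Basic computable functions -/

theorem Computable.linear {d : Fin (M + 1) → ℕ} (A : WeightSpace d →ₗ[ℝ] WeightSpace d)
    (hA : ∀ P ∈ symmetryGroup d, ∀ u, A (act P u) = act P (A u))
    {f : WeightSpace d → WeightSpace d} (hf : Computable f) : Computable fun v => A (f v) :=
  Computable.affine A.toAffineMap hA hf

theorem Computable.smul {d : Fin (M + 1) → ℕ} (r : ℝ)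
    {f : WeightSpace d → WeightSpace d} (hf : Computable f) : Computable fun v => r • f v :=
  Computable.linear (r • LinearMap.id) (fun P _ u => by simp [act_smul]) hf

theorem Computable.sub {d : Fin (M + 1) → ℕ} {f g : WeightSpace d → WeightSpace d}
    (hf : Computable f) (hg : Computable g) : Computable fun v => f v - g v := by
  simpa [sub_eq_add_neg] using hf.add (hg.smul (-1))

theorem act_entrywise_const {d : Fin (M + 1) → ℕ}
    {P : (m : Fin (M + 1)) → Matrix (Fin (d m)) (Fin (d m)) ℝ} (hP : P ∈ symmetryGroup d) (r : ℝ) :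
    act P (entrywise (fun _ => r) (0 : WeightSpace d)) = entrywise (fun _ => r) 0 := by
  rw [← entrywise_act _ hP]
  rfl

theorem Computable.const {d : Fin (M + 1) → ℕ} (r : ℝ) :
    Computable fun _ : WeightSpace d => entrywise (fun _ => r) (0 : WeightSpace d) :=
  Computable.affine (AffineMap.const ℝ _ _) (fun _ hP _ => (act_entrywise_const hP r).symm)
    Computable.id

/-! ### Uniform limits of computable functions -/

/-- The restrictions to `K` of the computable functions. -/
def computableOn {d : Fin (M + 1) → ℕ} (K : Set (WeightSpace d)) : Set C(K, WeightSpace d) :=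
  {g | ∃ f, Computable f ∧ ∀ v, g v = f v}

theorem id_mem_closure {d : Fin (M + 1) → ℕ} (K : Set (WeightSpace d)) :
    (⟨Subtype.val, continuous_subtype_val⟩ : C(K, WeightSpace d)) ∈ closure (computableOn K) :=
  subset_closure ⟨_, Computable.id, fun _ => rfl⟩

theorem const_mem_closure {d : Fin (M + 1) → ℕ} (K : Set (WeightSpace d)) (u : WeightSpace d)
    (hu : ∀ P ∈ symmetryGroup d, act P u = u) :
    ContinuousMap.const K u ∈ closure (computableOn K) :=
  subset_closure ⟨_, Computable.affine (AffineMap.const ℝ _ u) (fun P hP _ => (hu P hP).symm)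
    Computable.id, fun _ => rfl⟩

theorem add_mem_closure {d : Fin (M + 1) → ℕ} {K : Set (WeightSpace d)} {g h : C(K, WeightSpace d)}
    (hg : g ∈ closure (computableOn K)) (hh : h ∈ closure (computableOn K)) :
    g + h ∈ closure (computableOn K) :=
  map_mem_closure₂ continuous_add hg hh fun _ ⟨f₁, h₁, e₁⟩ _ ⟨f₂, h₂, e₂⟩ =>
    ⟨_, h₁.add h₂, fun v => by simp [e₁, e₂]⟩

theorem linear_mem_closure {d : Fin (M + 1) → ℕ} {K : Set (WeightSpace d)}
    (A : WeightSpace d →ₗ[ℝ] WeightSpace d)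
    (hA : ∀ P ∈ symmetryGroup d, ∀ u, A (act P u) = act P (A u)) {g : C(K, WeightSpace d)}
    (hg : g ∈ closure (computableOn K)) :
    (⟨A, A.continuous_of_finiteDimensional⟩ : C(WeightSpace d, WeightSpace d)).comp g ∈
      closure (computableOn K) :=
  map_mem_closure (ContinuousMap.continuous_postcomp _) hg fun _ ⟨f, hf, e⟩ =>
    ⟨_, hf.linear A hA, fun v => by simp [e]⟩

theorem continuous_entrywise {X : Type*} [TopologicalSpace X] {d : Fin (M + 1) → ℕ}
    {φ : X → ℝ → ℝ} (hφ : Continuous fun p : X × ℝ => φ p.1 p.2) {g : X → WeightSpace d}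
    (hg : Continuous g) : Continuous fun x => entrywise (φ x) (g x) := by
  refine continuous_pi fun k => Continuous.prodMk ?_ ?_
  · refine continuous_matrix fun i j => hφ.comp (continuous_id.prodMk ?_)
    exact ((continuous_apply k).comp hg).fst.matrix_elem i j
  · refine continuous_pi fun i => hφ.comp (continuous_id.prodMk ?_)
    exact (continuous_apply i).comp ((continuous_apply k).comp hg).snd

theorem exists_entry_bound {d : Fin (M + 1) → ℕ} {K : Set (WeightSpace d)} (hK : IsCompact K)
    (g : C(K, WeightSpace d)) :
    ∃ R : ℝ, 0 ≤ R ∧ ∀ v k i, (∀ j, |(g v k).1 i j| ≤ R) ∧ |(g v k).2 i| ≤ R := by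
  have : CompactSpace K := isCompact_iff_compactSpace.mp hK
  -- The entries are repackaged as one map into an iterated product, whose sup norm bounds them all.
  let G : C(K, (k : Fin M) → Fin (d k.succ) → ((Fin (d k.castSucc) → ℝ) × ℝ)) :=
    ⟨fun v k i => (fun j => (g v k).1 i j, (g v k).2 i), by
      refine continuous_pi fun k => continuous_pi fun i => ?_
      have hk : Continuous fun v => g v k := (continuous_apply k).comp g.continuous
      exact (continuous_pi fun j => hk.fst.matrix_elem i j).prodMk
        ((continuous_apply i).comp hk.snd)⟩
  refine ⟨‖G‖, norm_nonneg _, fun v k i => ?_⟩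
  have h : ‖G v k i‖ ≤ ‖G‖ :=
    ((norm_le_pi_norm _ i).trans (norm_le_pi_norm _ k)).trans (G.norm_coe_le_norm v)
  exact ⟨fun j => ((norm_le_pi_norm (G v k i).1 j).trans (norm_fst_le _)).trans h,
    (norm_snd_le (G v k i)).trans h⟩

/-! ### Entrywise continuous functions and products -/

/-- The scalar functions on an interval whose entrywise application, for some extension to the
real line, preserves computability. -/
def preservingComputable (d : Fin (M + 1) → ℕ) (a b : ℝ) : Set C(Set.Icc a b, ℝ) :=
  {p | ∃ q : ℝ → ℝ, (∀ t : Set.Icc a b, q t = p t) ∧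
    ∀ f : WeightSpace d → WeightSpace d, Computable f → Computable fun v => entrywise q (f v)}

/-- Lattice form of Stone–Weierstrass: ReLU and subtraction give minima and maxima, and an affine
function attains any prescribed values at two points. -/
theorem closure_preservingComputable (d : Fin (M + 1) → ℕ) (a b : ℝ) :
    closure (preservingComputable d a b) = ⊤ := by
  have hmin : ∀ x y : ℝ, min x y = x - max (x - y) 0 := fun x y => by
    rcases le_total x y with h | h <;> simp [h]
  have hmax : ∀ x y : ℝ, max x y = x + max (y - x) 0 := fun x y => by
    rcases le_total x y with h | h <;> simp [h]
  refine ContinuousMap.sublattice_closure_eq_top _ ⟨0, fun _ => 0, fun _ => rfl, ?_⟩ ?_ ?_ ?_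
  · exact fun f _ => Computable.const 0
  · rintro p ⟨q, hq, hc⟩ p' ⟨q', hq', hc'⟩
    refine ⟨fun t => q t ⊓ q' t, fun t => by simp [hq, hq'], fun f hf => ?_⟩
    convert (hc f hf).sub ((hc f hf).sub (hc' f hf)).relu using 2 with v
    funext k
    refine Prod.ext ?_ ?_
    · ext i j
      exact hmin _ _
    · ext i
      exact hmin _ _
  · rintro p ⟨q, hq, hc⟩ p' ⟨q', hq', hc'⟩
    refine ⟨fun t => q t ⊔ q' t, fun t => by simp [hq, hq'], fun f hf => ?_⟩
    convert (hc f hf).add ((hc' f hf).sub (hc f hf)).relu using 2 with v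
    funext k
    refine Prod.ext ?_ ?_
    · ext i j
      exact hmax _ _
    · ext i
      exact hmax _ _
  · intro v x y
    obtain ⟨r, s, hx, hy⟩ : ∃ r s : ℝ, r * x + s = v x ∧ r * y + s = v y := by
      by_cases h : x = y
      · subst h; exact ⟨0, v x, by simp, by simp⟩
      · have : (x : ℝ) - y ≠ 0 := fun h' => h (Subtype.ext (sub_eq_zero.mp h'))
        refine ⟨(v x - v y) / (x - y), v x - (v x - v y) / (x - y) * x, by ring, ?_⟩
        field_simp
        ring
    refine ⟨⟨fun t => r * t + s, by fun_prop⟩, ⟨fun t => r * t + s, fun _ => rfl, ?_⟩, hx, hy⟩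
    intro f hf
    exact (hf.smul r).add (Computable.const s)

/-- Currying a jointly continuous evaluation makes `E` continuous, so that limits of scalar
functions become limits in `C(X, WeightSpace d)`. -/
theorem continuous_entrywise_IccExtend {X : Type*} [TopologicalSpace X] {d : Fin (M + 1) → ℕ}
    {a b : ℝ} (h : a ≤ b) (g : C(X, WeightSpace d)) :
    ∃ E : C(Set.Icc a b, ℝ) → C(X, WeightSpace d), Continuous E ∧
      ∀ p x, E p x = entrywise (Set.IccExtend h p) (g x) := by
  have hE : Continuous fun y : C(Set.Icc a b, ℝ) × X =>
      entrywise (Set.IccExtend h y.1) (g y.2) := by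
    refine continuous_entrywise (φ := fun y : C(Set.Icc a b, ℝ) × X => Set.IccExtend h y.1) ?_
      (g.continuous.comp continuous_snd)
    exact ContinuousEval.continuous_eval.comp
      ((continuous_fst.comp continuous_fst).prodMk ((continuous_projIcc (h := h)).comp continuous_snd))
  exact ⟨fun p => ⟨fun x => entrywise (Set.IccExtend h p) (g x),
      hE.comp (Continuous.prodMk_right p)⟩,
    ContinuousMap.continuous_of_continuous_uncurry _ hE, fun _ _ => rfl⟩

theorem entrywise_mem_closure_of_mem {d : Fin (M + 1) → ℕ} {K : Set (WeightSpace d)}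
    (hK : IsCompact K) {φ : ℝ → ℝ} (hφ : Continuous φ) {g : C(K, WeightSpace d)}
    (hg : g ∈ computableOn K) :
    (⟨fun v => entrywise φ (g v), continuous_entrywise (hφ.comp continuous_snd) g.continuous⟩ :
      C(K, WeightSpace d)) ∈ closure (computableOn K) := by
  obtain ⟨R, hR0, hR⟩ := exists_entry_bound hK g
  have hle : -R ≤ R := by linarith
  obtain ⟨E, hE, hEg⟩ := continuous_entrywise_IccExtend hle g
  -- All entries of `g` lie in `[-R, R]`, so it is irrelevant how a scalar function is extended
  -- beyond this interval.
  have hext : ∀ (p : C(Set.Icc (-R) R, ℝ)) (q : ℝ → ℝ), (∀ t : Set.Icc (-R) R, q t = p t) →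
      ∀ v, E p v = entrywise q (g v) := by
    intro p q hq v
    rw [hEg]
    have key : ∀ t, |t| ≤ R → Set.IccExtend hle p t = q t := fun t ht => by
      rw [Set.IccExtend_of_mem hle p (abs_le.mp ht), ← hq]
    funext k
    refine Prod.ext ?_ ?_
    · ext i j
      exact key _ ((hR v k i).1 j)
    · ext i
      exact key _ (hR v k i).2
  have hmem := map_mem_closure hE (t := computableOn K)
    (show (⟨fun t => φ t, by fun_prop⟩ : C(Set.Icc (-R) R, ℝ)) ∈ closure (preservingComputable d (-R) R) by
      rw [closure_preservingComputable]; trivial) (by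
      rintro p ⟨q, hq, hc⟩
      obtain ⟨f, hf, e⟩ := hg
      exact ⟨_, hc f hf, fun v => by rw [hext p q hq, e]⟩)
  convert hmem using 1
  ext1 v
  exact (hext _ φ (fun _ => rfl) v).symm

/-- Composition with a fixed continuous map is continuous on `C(K, WeightSpace d)`, so the case of
computable `g` passes to limits. -/
theorem entrywise_mem_closure {d : Fin (M + 1) → ℕ} {K : Set (WeightSpace d)}
    (hK : IsCompact K) {φ : ℝ → ℝ} (hφ : Continuous φ) {g : C(K, WeightSpace d)}
    (hg : g ∈ closure (computableOn K)) :
    (⟨fun v => entrywise φ (g v), continuous_entrywise (hφ.comp continuous_snd) g.continuous⟩ :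
      C(K, WeightSpace d)) ∈ closure (computableOn K) := by
  have hc : Continuous (entrywise φ : WeightSpace d → WeightSpace d) :=
    continuous_entrywise (hφ.comp continuous_snd) continuous_id
  have := map_mem_closure (ContinuousMap.continuous_postcomp (X := K) ⟨_, hc⟩) hg
    (t := closure (computableOn K)) fun g hg => entrywise_mem_closure_of_mem hK hφ hg
  rwa [closure_closure] at this

/-- The entrywise product. -/
def hadamard {d : Fin (M + 1) → ℕ} (u v : WeightSpace d) : WeightSpace d :=
  fun k => (Matrix.of fun i j => (u k).1 i j * (v k).1 i j, fun i => (u k).2 i * (v k).2 i)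

/-- Polarization: `st = ((s + t)² - s² - t²) / 2`, with squaring as an entrywise continuous map. -/
theorem exists_hadamard_mem_closure {d : Fin (M + 1) → ℕ} {K : Set (WeightSpace d)}
    (hK : IsCompact K) {g h : C(K, WeightSpace d)}
    (hg : g ∈ closure (computableOn K)) (hh : h ∈ closure (computableOn K)) :
    ∃ p ∈ closure (computableOn K), ∀ v, p v = hadamard (g v) (h v) := by
  have smul : ∀ (r : ℝ) (f : C(K, WeightSpace d)), f ∈ closure (computableOn K) →
      r • f ∈ closure (computableOn K) := fun r f hf => by
    convert linear_mem_closure (r • LinearMap.id) (fun P _ u => by simp [act_smul]) hf using 1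
    ext1 v
    rfl
  have sq : Continuous fun t : ℝ => t ^ 2 := by fun_prop
  refine ⟨_, smul (1 / 2) _ (add_mem_closure
    (entrywise_mem_closure hK sq (add_mem_closure hg hh)) (add_mem_closure
      (smul (-1) _ (entrywise_mem_closure hK sq hg))
      (smul (-1) _ (entrywise_mem_closure hK sq hh)))), fun v => ?_⟩
  funext k
  refine Prod.ext ?_ ?_
  · ext i j
    simp [entrywise, hadamard]; ring
  · ext i
    simp [entrywise, hadamard]; ring

/-! ### Simulation of the forward pass -/

/-- The biases of the preceding layer, with `x` in place of the missing biases of the input layer. -/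
def precedingBias {d : Fin (M + 1) → ℕ} (x : Fin (d 0) → ℝ) (u : WeightSpace d) (m : Fin (M + 1)) :
    Fin (d m) → ℝ :=
  Fin.cases (motive := fun m => Fin (d m) → ℝ) x (fun k => (u k).2) m

/-- Copies the biases of the preceding layer into every row of the weight matrices. -/
def broadcast {d : Fin (M + 1) → ℕ} : WeightSpace d →ₗ[ℝ] WeightSpace d where
  -- The input layer contributes `0` to keep the map linear; `inputWeights` supplies `x` separately.
  toFun u k := (Matrix.of fun _ j => precedingBias 0 u k.castSucc j, 0)
  map_add' u v := by
    have h : ∀ m j, precedingBias 0 (u + v) m j = precedingBias 0 u m j + precedingBias 0 v m j := by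
      intro m
      refine Fin.cases (fun j => ?_) (fun k j => ?_) m <;> simp [precedingBias]
    funext k
    refine Prod.ext ?_ ?_
    · ext i j
      exact h k.castSucc _
    · simp
  map_smul' r u := by
    have h : ∀ m j, precedingBias 0 (r • u) m j = r * precedingBias 0 u m j := by
      intro m
      refine Fin.cases (fun j => ?_) (fun k j => ?_) m <;> simp [precedingBias]
    funext k
    refine Prod.ext ?_ ?_
    · ext i j
      exact h k.castSucc _
    · simp

theorem broadcast_act {d : Fin (M + 1) → ℕ}
    (P : (m : Fin (M + 1)) → Matrix (Fin (d m)) (Fin (d m)) ℝ) (hP : P ∈ symmetryGroup d)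
    (u : WeightSpace d) : broadcast (act P u) = act P (broadcast u) := by
  obtain ⟨π, -, hπ⟩ := exists_perm_act hP
  have h : ∀ m j, precedingBias 0 (act P u) m j = precedingBias 0 u m (π m j) := by
    intro m
    refine Fin.cases (fun j => ?_) (fun k j => ?_) m <;> simp [precedingBias, hπ]
  funext k
  rw [hπ]
  refine Prod.ext ?_ ?_
  · ext i j
    exact h k.castSucc _
  · rfl

/-- Adds up the rows of the weight matrices, the results being stored in the biases. -/
def rowSum {d : Fin (M + 1) → ℕ} : WeightSpace d →ₗ[ℝ] WeightSpace d where
  toFun u k := (0, fun i => ∑ j, (u k).1 i j)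
  map_add' u v := by
    funext k
    refine Prod.ext (by simp) ?_
    ext i
    simp [Finset.sum_add_distrib]
  map_smul' r u := by
    funext k
    refine Prod.ext (by simp) ?_
    ext i
    simp [Finset.mul_sum]

theorem rowSum_act {d : Fin (M + 1) → ℕ}
    (P : (m : Fin (M + 1)) → Matrix (Fin (d m)) (Fin (d m)) ℝ) (hP : P ∈ symmetryGroup d)
    (u : WeightSpace d) : rowSum (act P u) = act P (rowSum u) := by
  obtain ⟨π, -, hπ⟩ := exists_perm_act hP
  funext k
  rw [hπ]
  refine Prod.ext ?_ ?_
  · rfl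
  · ext i
    simp only [rowSum, LinearMap.coe_mk, AddHom.coe_mk, hπ, Matrix.of_apply]
    exact Equiv.sum_comp (π k.castSucc) fun j => (u k).1 (π k.succ i) j

/-- The weights with every row of the first weight matrix equal to `x`, and zeros elsewhere. -/
def inputWeights {d : Fin (M + 1) → ℕ} (x : Fin (d 0) → ℝ) : WeightSpace d :=
  fun k => (Matrix.of fun _ j => precedingBias x 0 k.castSucc j, 0)

/-- All rows are equal, so row permutations have no effect, and the columns of the first matrix are
fixed because `P 0 = 1`. -/
theorem act_inputWeights {d : Fin (M + 1) → ℕ} (x : Fin (d 0) → ℝ)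
    (P : (m : Fin (M + 1)) → Matrix (Fin (d m)) (Fin (d m)) ℝ) (hP : P ∈ symmetryGroup d) :
    act P (inputWeights x) = inputWeights x := by
  obtain ⟨π, h0, hπ⟩ := exists_perm_act hP
  have h : ∀ m j, precedingBias x (0 : WeightSpace d) m (π m j) = precedingBias x 0 m j := by
    intro m
    refine Fin.cases (fun j => ?_) (fun k j => ?_) m <;> simp [precedingBias, h0]
  funext k
  rw [hπ]
  refine Prod.ext ?_ ?_
  · ext i j
    exact h k.castSucc _
  · rfl

theorem precedingBias_add {d : Fin (M + 1) → ℕ} (x : Fin (d 0) → ℝ) (u : WeightSpace d)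
    (m : Fin (M + 1)) (j : Fin (d m)) :
    precedingBias 0 u m j + precedingBias x 0 m j = precedingBias x u m j := by
  revert j
  refine Fin.cases (fun j => ?_) (fun k j => ?_) m <;> simp [precedingBias]

/-- A matrix-vector product is the row sum of the entrywise product of `W` with the vector copied
into each row. All layers are updated at once, and only the biases of `g` are read. -/
theorem exists_forward_step {d : Fin (M + 1) → ℕ} {σ : ℝ → ℝ} (hσ : Continuous σ)
    {K : Set (WeightSpace d)} (hK : IsCompact K) (x : Fin (d 0) → ℝ) {g : C(K, WeightSpace d)}
    (hg : g ∈ closure (computableOn K)) :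
    ∃ h ∈ closure (computableOn K), ∀ (v : K) k i, (h v k).2 i =
      σ (((v.1 k).1 *ᵥ precedingBias x (g v) k.castSucc + (v.1 k).2) i) := by
  obtain ⟨p, hp, hpe⟩ := exists_hadamard_mem_closure hK (id_mem_closure K)
    (add_mem_closure (linear_mem_closure broadcast broadcast_act hg)
      (const_mem_closure K (inputWeights x) (act_inputWeights x)))
  refine ⟨_, entrywise_mem_closure hK hσ (add_mem_closure
    (linear_mem_closure rowSum rowSum_act hp) (id_mem_closure K)), fun v k i => ?_⟩
  simp [entrywise, rowSum, hpe, hadamard, broadcast, inputWeights, Matrix.mulVec, dotProduct,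
    precedingBias_add]

/-- On a compact set, the activations of all layers are limits of computable functions. -/
theorem exists_activation_mem_closure {d : Fin (M + 1) → ℕ} {σ : ℝ → ℝ} (hσ : Continuous σ)
    {K : Set (WeightSpace d)} (hK : IsCompact K) (x : Fin (d 0) → ℝ) :
    ∃ g ∈ closure (computableOn K), ∀ (v : K) k, (g v k).2 = activation σ v.1 x k.succ := by
  -- After `n` rounds the activations of layers `1, …, n` are correct; later layers hold irrelevant
  -- values. Any start works, since the first layer reads only `x`.
  have key : ∀ n : ℕ, ∃ g ∈ closure (computableOn K), ∀ (v : K) (k : Fin M), (k : ℕ) < n →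
      (g v k).2 = activation σ v.1 x k.succ := by
    intro n
    induction n with
    | zero => exact ⟨_, id_mem_closure K, fun _ _ h => absurd h (Nat.not_lt_zero _)⟩
    | succ n ih =>
      obtain ⟨g, hg, hga⟩ := ih
      obtain ⟨h, hh, hha⟩ := exists_forward_step hσ hK x hg
      refine ⟨h, hh, fun v k hk => ?_⟩
      have hprev : precedingBias x (g v) k.castSucc = activation σ v.1 x k.castSucc := by
        have aux : ∀ m : Fin (M + 1), (m : ℕ) < n + 1 →
            precedingBias x (g v) m = activation σ v.1 x m := by
          intro m
          refine Fin.cases (fun _ => rfl) (fun j hj => ?_) m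
          exact hga v j (by simpa using hj)
        exact aux _ (by simpa using hk)
      funext i
      rw [hha, hprev]
      simp [activation]
  obtain ⟨g, hg, hga⟩ := key M
  exact ⟨g, hg, fun v k => hga v k k.2⟩

/-! ### Uniform approximation of the cost matrices -/

/-- Computable functions that approximate the cost matrices uniformly on a compact set. -/
theorem exists_computable_costMatrix {d : Fin (M + 1) → ℕ} {σ : ℝ → ℝ} (hσ : Continuous σ)
    {K : Set (WeightSpace d)} (hK : IsCompact K) {N : ℕ} (x : Fin N → Fin (d 0) → ℝ) {η : ℝ}
    (hη : 0 < η) :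
    ∃ h : Fin N → WeightSpace d → WeightSpace d, (∀ l, Computable (h l)) ∧
      (∀ l, ContinuousOn (h l) K) ∧ ∀ v ∈ K, ∀ v' ∈ K, ∀ k i j,
        |∑ l, (h l v k).2 i * (h l v' k).2 j - costMatrix σ x v v' k i j| < η := by
  have : CompactSpace K := isCompact_iff_compactSpace.mp hK
  choose g hg hga using fun l => exists_activation_mem_closure hσ hK (x l)
  let Y := (k : Fin M) → Fin (d k.succ) → Fin (d k.succ) → ℝ
  have hcont : Continuous fun y : (Fin N → C(K, WeightSpace d)) × (K × K) =>
      (fun k i j => ∑ l, (y.1 l y.2.1 k).2 i * (y.1 l y.2.2 k).2 j : Y) := by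
    refine continuous_pi fun k => continuous_pi fun i => continuous_pi fun j =>
      continuous_finsetSum _ fun l _ => ?_
    have h1 : Continuous fun y : (Fin N → C(K, WeightSpace d)) × (K × K) => y.1 l y.2.1 :=
      ContinuousEval.continuous_eval.comp
        (((continuous_apply l).comp continuous_fst).prodMk (continuous_fst.comp continuous_snd))
    have h2 : Continuous fun y : (Fin N → C(K, WeightSpace d)) × (K × K) => y.1 l y.2.2 :=
      ContinuousEval.continuous_eval.comp
        (((continuous_apply l).comp continuous_fst).prodMk (continuous_snd.comp continuous_snd))
    exact ((continuous_apply i).comp ((continuous_apply k).comp h1).snd).mul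
      ((continuous_apply j).comp ((continuous_apply k).comp h2).snd)
  -- `Φ` sends the channels to the resulting matrices for all pairs in `K × K`. Its continuity
  -- replaces an explicit estimate of how errors in the factors affect the products.
  let Φ : (Fin N → C(K, WeightSpace d)) → C(K × K, Y) := fun f =>
    ⟨_, hcont.comp (Continuous.prodMk_right f)⟩
  have hΦ : Continuous Φ := ContinuousMap.continuous_of_continuous_uncurry _ hcont
  have hmem : g ∈ closure (Set.univ.pi fun _ : Fin N => computableOn K) := by
    rw [closure_pi_set]
    exact fun l _ => hg l
  obtain ⟨_, ⟨f, hf, rfl⟩, hdist⟩ :=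
    Metric.mem_closure_iff.mp (map_mem_closure hΦ hmem (Set.mapsTo_image Φ _)) η hη
  choose h hh hhf using fun l => hf l (Set.mem_univ l)
  refine ⟨h, hh, fun l => ?_, fun v hv v' hv' k i j => ?_⟩
  · rw [continuousOn_iff_continuous_domRestrict]
    convert (f l).continuous using 1
    funext v
    exact (hhf l v).symm
  · have hd := (ContinuousMap.dist_apply_le_dist (f := Φ g) (g := Φ f)
      (⟨v, hv⟩, ⟨v', hv'⟩)).trans_lt hdist
    have hk := (dist_le_pi_dist _ _ k).trans_lt hd
    have hi := (dist_le_pi_dist _ _ i).trans_lt hk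
    have hj := (dist_le_pi_dist _ _ j).trans_lt hi
    rw [dist_comm, Real.dist_eq] at hj
    simpa [Φ, costMatrix, hhf, hga] using hj

/-! ### Stability of the linear assignment problem -/

theorem frob_permMatrix {n : ℕ} (Q : Matrix (Fin n) (Fin n) ℝ) (π : Equiv.Perm (Fin n)) :
    frob Q (π.permMatrix ℝ) = ∑ i, Q i (π i) := by
  simp [frob, PEquiv.toMatrix_apply, Equiv.toPEquiv_apply]

/-- Terms that depend only on the row or only on the column do not change an assignment problem,
and small errors do not change a strict optimum. -/
theorem frob_lt_frob_of_approx {n : ℕ} {Z Q P : Matrix (Fin n) (Fin n) ℝ} {ε η : ℝ}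
    (f g : Fin n → ℝ) (hP : IsPermMatrix P)
    (hZ : ∀ R, IsPermMatrix R → R ≠ P → frob Z R + ε < frob Z P)
    (hQ : ∀ i j, |Q i j - Z i j - f i - g j| ≤ η) (hη : 2 * (n * η) ≤ ε)
    {R : Matrix (Fin n) (Fin n) ℝ} (hR : IsPermMatrix R) (hne : R ≠ P) :
    frob Q R < frob Q P := by
  -- A permutation meets every row and column once, so `f` and `g` contribute the same total for
  -- each `R`. The error `n * η` occurs twice, for `R` and for `P`, hence the hypothesis on `ε`.
  have key : ∀ {R}, IsPermMatrix R → |frob Q R - frob Z R - ∑ i, f i - ∑ j, g j| ≤ n * η := by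
    rintro _ ⟨π, rfl⟩
    rw [frob_permMatrix, frob_permMatrix, ← Equiv.sum_comp π g, ← Finset.sum_sub_distrib,
      ← Finset.sum_sub_distrib, ← Finset.sum_sub_distrib]
    refine (Finset.abs_sum_le_sum_abs _ _).trans ?_
    refine (Finset.sum_le_sum fun i _ => hQ i (π i)).trans ?_
    simp
  have h1 := abs_le.mp (key hR)
  have h2 := abs_le.mp (key hP)
  have h3 := hZ R hR hne
  linarith [h1.2, h2.1]

/-- Here `g` is fixed before `Q`, so the same `g` serves both the cost matrices and the output of
the product layer. -/
theorem exists_assignments_eq {d : Fin (M + 1) → ℕ}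
    (P : (k : Fin M) → Matrix (Fin (d k.succ)) (Fin (d k.succ)) ℝ)
    (hP : ∀ k, k.succ ≠ Fin.last M → IsPermMatrix (P k)) :
    ∃ g ∈ symmetryGroup d, ∀ Q : (k : Fin M) → Matrix (Fin (d k.succ)) (Fin (d k.succ)) ℝ,
      (∀ k, k.succ ≠ Fin.last M → ∀ R, IsPermMatrix R → R ≠ P k → frob (Q k) R < frob (Q k) (P k)) →
      assignments Q = {g} := by
  have perm_one : ∀ n, IsPermMatrix (1 : Matrix (Fin n) (Fin n) ℝ) := fun n => ⟨1, by simp⟩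
  let g : (m : Fin (M + 1)) → Matrix (Fin (d m)) (Fin (d m)) ℝ :=
    Fin.cases 1 fun k => if k.succ = Fin.last M then 1 else P k
  have g_zero : g 0 = 1 := rfl
  have g_succ : ∀ k : Fin M, g k.succ = if k.succ = Fin.last M then 1 else P k := fun _ => rfl
  have g_last : g (Fin.last M) = 1 := by
    -- A general `m` permits the case split; for `M = 0` the last layer is the input layer.
    have : ∀ m, m = Fin.last M → g m = 1 := by
      intro m
      refine Fin.cases (fun _ => g_zero) (fun k hk => ?_) m
      rw [g_succ, if_pos hk]
    exact this _ rfl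
  have g_mem : g ∈ symmetryGroup d := by
    refine ⟨fun m => ?_, g_zero, g_last⟩
    refine Fin.cases (g_zero ▸ perm_one _) (fun k => ?_) m
    rw [g_succ]
    split_ifs with hk
    · exact perm_one _
    · exact hP k hk
  refine ⟨g, g_mem, fun Q hQ => Set.eq_singleton_iff_unique_mem.mpr ⟨⟨g_mem, fun k hk => ?_⟩, ?_⟩⟩
  · rw [g_succ, if_neg hk]
    refine ⟨hP k hk, fun R hR => ?_⟩
    by_cases h : R = P k
    · rw [h]
    · exact (hQ k hk R hR h).le
  · rintro P' ⟨⟨hperm, h0, hlast⟩, hopt⟩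
    funext m
    by_cases hm : m = Fin.last M
    · subst hm
      rw [hlast, g_last]
    revert hm
    refine Fin.cases (fun _ => h0) (fun k hk => ?_) m
    rw [g_succ, if_neg hk]
    by_contra hne
    exact ((hQ k hk _ (hperm _) hne).trans_le ((hopt k hk).2 _ (hP k hk))).false

/-! ### The product layer -/

/-- With a large constant channel, both product layers agree with the product of the remaining
channels, up to a small error and terms depending on one argument only. -/
theorem exists_phi_approx (N : ℕ) {B η : ℝ} (hη : 0 < η) :
    ∃ C : ℝ, ∀ κ, ∃ f : EuclideanSpace ℝ (Fin (N + 1)) → ℝ,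
      ∀ a b : EuclideanSpace ℝ (Fin (N + 1)), a (Fin.last N) = C → b (Fin.last N) = C →
        ∑ l : Fin N, a l.castSucc ^ 2 ≤ B → ∑ l : Fin N, b l.castSucc ^ 2 ≤ B →
        |phi κ C a b - ∑ l : Fin N, a l.castSucc * b l.castSucc - f a - f b| ≤ η := by
  -- Multiplied by `C ^ 2`, the two error terms of the normalized case are at most `B ^ 2` and `2 *
  -- B ^ 2`. The summand `1` ensures `C ≤ C ^ 2`.
  obtain ⟨C, hC⟩ : ∃ C, C = 3 * B ^ 2 / η + 1 := ⟨_, rfl⟩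
  have hC1 : 1 ≤ C := by rw [hC]; linarith [show 0 ≤ 3 * B ^ 2 / η by positivity]
  have hC0 : 0 < C := by linarith
  have hCη : 3 * B ^ 2 ≤ η * C ^ 2 := by
    have h1 : 3 * B ^ 2 / η ≤ C ^ 2 := by nlinarith
    rw [div_le_iff₀ hη] at h1
    linarith
  have hinner : ∀ a b : EuclideanSpace ℝ (Fin (N + 1)), a (Fin.last N) = C → b (Fin.last N) = C →
      inner ℝ a b = ∑ l : Fin N, a l.castSucc * b l.castSucc + C ^ 2 := by
    intro a b ha hb
    rw [PiLp.inner_apply, Fin.sum_univ_castSucc, ha, hb]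
    simp [mul_comm, sq]
  refine ⟨C, fun κ => ?_⟩
  match κ with
  | .plain =>
    -- The constant channel adds exactly `C ^ 2`, split evenly between the two arguments.
    refine ⟨fun _ => C ^ 2 / 2, fun a b ha hb _ _ => ?_⟩
    rw [phi, hinner a b ha hb]
    ring_nf
    simpa using hη.le
  | .normalized =>
    -- The ratio `w = C / ‖a‖` is within `B / C ^ 2` of `1`, because `C * (‖a‖ - C) ≤ ‖a‖ ^ 2 - C ^
    -- 2 ≤ B`.
    have hw : ∀ a : EuclideanSpace ℝ (Fin (N + 1)), a (Fin.last N) = C →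
        ∑ l : Fin N, a l.castSucc ^ 2 ≤ B →
        0 < C * ‖a‖⁻¹ ∧ C * ‖a‖⁻¹ ≤ 1 ∧ C ^ 2 * (1 - C * ‖a‖⁻¹) ≤ B := by
      intro a ha hB
      have hsq : ‖a‖ ^ 2 = ∑ l : Fin N, a l.castSucc ^ 2 + C ^ 2 := by
        rw [← real_inner_self_eq_norm_sq, hinner a a ha ha]
        simp [sq]
      have hα : 0 ≤ ∑ l : Fin N, a l.castSucc ^ 2 := Finset.sum_nonneg fun _ _ => sq_nonneg _
      have hle : C ≤ ‖a‖ := abs_le_of_sq_le_sq' (by linarith) (norm_nonneg a) |>.2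
      have hpos : 0 < ‖a‖ := hC0.trans_le hle
      have hw1 : C * ‖a‖⁻¹ ≤ 1 := by
        rw [← div_eq_mul_inv, div_le_one hpos]
        exact hle
      refine ⟨by positivity, hw1, ?_⟩
      have e : (C * ‖a‖⁻¹) * ‖a‖ = C := by field_simp
      have : C ^ 2 * (1 - C * ‖a‖⁻¹) = C * (C * ‖a‖⁻¹) * (‖a‖ - C) := by
        field_simp
      rw [this]
      have h2 : C * (C * ‖a‖⁻¹) ≤ C := mul_le_of_le_one_right hC0.le hw1
      nlinarith
    -- With `w = C / ‖a‖`, `u = C / ‖b‖` and `γ` the product of the other channels, `phi` equals `w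
    -- * u * (γ + C ^ 2)`. Here `f a + f b` is the linearization of `C ^ 2 * w * u` at `w = u = 1`,
    -- which leaves `C ^ 2 * (1 - w) * (1 - u) - γ * (1 - w * u)`.
    refine ⟨fun a => C ^ 2 * (C * ‖a‖⁻¹) - C ^ 2 / 2, fun a b ha hb hBa hBb => ?_⟩
    obtain ⟨w0, w1, wB⟩ := hw a ha hBa
    obtain ⟨u0, u1, uB⟩ := hw b hb hBb
    have hγ : |∑ l : Fin N, a l.castSucc * b l.castSucc| ≤ B := by
      refine (Finset.abs_sum_le_sum_abs _ _).trans ?_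
      have : ∑ l : Fin N, |a l.castSucc * b l.castSucc| ≤
          ∑ l : Fin N, (a l.castSucc ^ 2 + b l.castSucc ^ 2) / 2 := by
        refine Finset.sum_le_sum fun l _ => abs_le.mpr ⟨?_, ?_⟩
        · nlinarith [sq_nonneg (a l.castSucc + b l.castSucc)]
        · nlinarith [sq_nonneg (a l.castSucc - b l.castSucc)]
      rw [← Finset.sum_div, Finset.sum_add_distrib] at this
      linarith
    rw [phi, real_inner_smul_left, real_inner_smul_right, hinner a b ha hb]
    beta_reduce
    generalize ∑ l : Fin N, a l.castSucc * b l.castSucc = γ at *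
    generalize ‖a‖⁻¹ = p at *
    generalize ‖b‖⁻¹ = q at *
    have e : C ^ 2 * (p * (q * (γ + C ^ 2))) - γ - (C ^ 2 * (C * p) - C ^ 2 / 2) -
        (C ^ 2 * (C * q) - C ^ 2 / 2) =
        C ^ 2 * (1 - C * p) * (1 - C * q) - γ * (1 - (C * p) * (C * q)) := by ring
    rw [e]
    generalize C * p = w at *
    generalize C * q = u at *
    have hB0 : 0 ≤ B := (abs_nonneg γ).trans hγ
    have h1 : 0 ≤ C ^ 2 * (C ^ 2 * (1 - w) * (1 - u)) ∧
        C ^ 2 * (C ^ 2 * (1 - w) * (1 - u)) ≤ B ^ 2 := by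
      have e1 : C ^ 2 * (C ^ 2 * (1 - w) * (1 - u)) = (C ^ 2 * (1 - w)) * (C ^ 2 * (1 - u)) := by
        ring
      have hw' : 0 ≤ 1 - w := by linarith
      have hu' : 0 ≤ 1 - u := by linarith
      rw [e1, sq B]
      exact ⟨by positivity, mul_le_mul wB uB (by positivity) hB0⟩
    have h2 : |C ^ 2 * (γ * (1 - w * u))| ≤ 2 * B ^ 2 := by
      have e2 : C ^ 2 * (γ * (1 - w * u)) = γ * (C ^ 2 * (1 - w * u)) := by ring
      have hwu : w * u ≤ 1 := mul_le_one₀ w1 u0.le u1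
      have h3 : C ^ 2 * (1 - w * u) ≤ 2 * B := by
        have : C ^ 2 * (1 - w * u) = C ^ 2 * (1 - w) + w * (C ^ 2 * (1 - u)) := by ring
        rw [this]
        have : w * (C ^ 2 * (1 - u)) ≤ 1 * (C ^ 2 * (1 - u)) :=
          mul_le_mul_of_nonneg_right w1 (mul_nonneg (sq_nonneg _) (by linarith))
        linarith
      have h4 : 0 ≤ C ^ 2 * (1 - w * u) := mul_nonneg (sq_nonneg _) (by linarith)
      rw [e2, abs_mul, abs_of_nonneg h4]
      calc _ ≤ B * (2 * B) := mul_le_mul hγ h3 h4 hB0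
        _ = 2 * B ^ 2 := by ring
    have h5 : C ^ 2 * |C ^ 2 * (1 - w) * (1 - u) - γ * (1 - w * u)| ≤ C ^ 2 * η := by
      rw [← abs_of_nonneg (sq_nonneg C), ← abs_mul, abs_of_nonneg (sq_nonneg C), mul_sub]
      have := abs_le.mp h2
      refine abs_le.mpr ⟨by linarith [h1.1], by linarith [h1.2]⟩
    exact le_of_mul_le_mul_left h5 (by positivity)

/-! ### Assembly of the network -/

/-- The architecture can simulate activation matching on a compact set of weights. -/
theorem exists_weights_F_eq_activationMatching (d : Fin (M + 1) → ℕ) (σ : ℝ → ℝ) (hσ : Continuous σ)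
    (K : Set (WeightSpace d)) (hK : IsCompact K)
    (N : ℕ) (x : Fin N → Fin (d 0) → ℝ) (ε : ℝ) (hε : 0 < ε) (κ : ProductKind) :
    ∃ A : Architecture, A.kind = κ ∧ ∃ θ : Weights d A,
      ∀ v ∈ K, ∀ v' ∈ K,
        (∀ k : Fin M, k.succ ≠ Fin.last M →
          IsFriendly ε (costMatrix σ x v v' k)) →
        ∃ g ∈ symmetryGroup d,
          activationMatching σ x v v' = {g} ∧ F θ v v' = {g} := by
  -- One `η` pays for the approximate activations, the other for the product layer.
  obtain ⟨η, hη, hdη⟩ : ∃ η : ℝ, 0 < η ∧ ∀ k : Fin M, 2 * (d k.succ * (η + η)) ≤ ε := by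
    have hD : ∀ k : Fin M, (d k.succ : ℝ) ≤ ∑ k : Fin M, (d k.succ : ℝ) := fun k =>
      Finset.single_le_sum (f := fun k : Fin M => (d k.succ : ℝ)) (fun _ _ => Nat.cast_nonneg _)
        (Finset.mem_univ k)
    have hD0 : 0 ≤ ∑ k : Fin M, (d k.succ : ℝ) := Finset.sum_nonneg fun _ _ => Nat.cast_nonneg _
    refine ⟨ε / (4 * (∑ k : Fin M, (d k.succ : ℝ) + 1)), by positivity, fun k => ?_⟩
    calc 2 * ((d k.succ : ℝ) * (ε / (4 * (∑ k : Fin M, (d k.succ : ℝ) + 1)) +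
          ε / (4 * (∑ k : Fin M, (d k.succ : ℝ) + 1))))
        = d k.succ * ε / (∑ k : Fin M, (d k.succ : ℝ) + 1) := by field_simp; ring
      _ ≤ ε := by
        rw [div_le_iff₀ (by positivity)]
        nlinarith [hD k]
  obtain ⟨h, hcomp, hcont, happrox⟩ := exists_computable_costMatrix hσ hK x hη
  obtain ⟨B, hB⟩ : ∃ B : ℝ, ∀ v ∈ K, ∀ (k : Fin M) (i : Fin (d k.succ)),
      ∑ l, (h l v k).2 i ^ 2 ≤ B := by
    obtain ⟨B, hB⟩ := hK.exists_bound_of_continuousOn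
      (f := fun v (k : Fin M) (i : Fin (d k.succ)) => ∑ l, (h l v k).2 i ^ 2) (by
        refine continuousOn_pi.mpr fun k => continuousOn_pi.mpr fun i =>
          continuousOn_finsetSum _ fun l _ => ContinuousOn.pow ?_ 2
        exact ((continuous_apply i).comp (continuous_snd.comp (continuous_apply k))).comp_continuousOn
          (hcont l))
    refine ⟨B, fun v hv k i => (le_abs_self _).trans (le_trans ?_ (hB v hv))⟩
    exact (norm_le_pi_norm (fun i => ∑ l, (h l v k).2 i ^ 2) i).trans
      (norm_le_pi_norm (fun (k : Fin M) (i : Fin (d k.succ)) => ∑ l, (h l v k).2 i ^ 2) k)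
  obtain ⟨C, hC⟩ := exists_phi_approx N (B := B) hη
  obtain ⟨f, hf⟩ := hC κ
  obtain ⟨hidden, w, hw⟩ := isRealized_of_computable (n := N + 1)
    (Fin.snoc h fun _ => entrywise (fun _ => C) (0 : WeightSpace d)) (by
      intro l
      refine Fin.lastCases ?_ (fun l => ?_) l
      · simpa using Computable.const C
      · simpa using hcomp l)
  -- `C` is both the value of the constant channel and the scale `s`.
  refine ⟨⟨κ, hidden, N + 1⟩, rfl, ⟨w, C⟩, fun v hv v' hv' hfr => ?_⟩
  have hP : ∀ k : Fin M, ∃ P, k.succ ≠ Fin.last M → IsPermMatrix P ∧ ∀ R, IsPermMatrix R → R ≠ P →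
      frob (costMatrix σ x v v' k) R + ε < frob (costMatrix σ x v v' k) P := by
    intro k
    by_cases hk : k.succ = Fin.last M
    · exact ⟨1, fun h => absurd hk h⟩
    · obtain ⟨P, hP⟩ := hfr k hk
      exact ⟨P, fun _ => hP⟩
  choose P hP using hP
  obtain ⟨g, hg, hgQ⟩ := exists_assignments_eq P fun k hk => (hP k hk).1
  -- Friendliness gives strict optimality of `P` for the cost matrices directly, and for the product
  -- layer by stability.
  refine ⟨g, hg, hgQ _ fun k hk R hR hne => ?_, hgQ _ fun k hk R hR hne => ?_⟩
  · linarith [(hP k hk).2 R hR hne]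
  · let a := fun u (i : Fin (d k.succ)) =>
      features (A := ⟨κ, hidden, N + 1⟩) ⟨w, C⟩ u k i
    have ha_last : ∀ u i, a u i (Fin.last N) = C := fun u i => by
      simp [a, features, toActivationSpace, hw, entrywise]
    have ha_castSucc : ∀ u i l, a u i (Fin.castSucc l) = (h l u k).2 i := fun u i l => by
      simp [a, features, toActivationSpace, hw]
    refine frob_lt_frob_of_approx (fun i => f (a v i)) (fun j => f (a v' j)) (hP k hk).1
      (hP k hk).2 (fun i j => ?_) (hdη k) hR hne
    have h1 := hf (a v i) (a v' j) (ha_last _ _) (ha_last _ _)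
      (by simpa only [ha_castSucc] using hB v hv k i)
      (by simpa only [ha_castSucc] using hB v' hv' k j)
    simp only [ha_castSucc] at h1
    have h2 := abs_lt.mp (happrox v hv v' hv' k i j)
    have h3 := abs_le.mp h1
    change |phi κ C (a v i) (a v' j) - _ - _ - _| ≤ _
    exact abs_le.mpr ⟨by linarith [h2.1, h3.1], by linarith [h2.2, h3.2]⟩

end DeepAlign

end

theorem proposition5p1 (M : ℕ) (d : Fin (M + 1) → ℕ) (σ : ℝ → ℝ) (hσ : Continuous σ)
    (K : Set (DeepAlign.WeightSpace d)) (hK : IsCompact K)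
    (N : ℕ) (x : Fin N → Fin (d 0) → ℝ) (ε : ℝ) (hε : 0 < ε) (κ : DeepAlign.ProductKind) :
    ∃ A : DeepAlign.Architecture, A.kind = κ ∧ ∃ θ : DeepAlign.Weights d A,
      ∀ v ∈ K, ∀ v' ∈ K,
        (∀ k : Fin M, k.succ ≠ Fin.last M →
          DeepAlign.IsFriendly ε (DeepAlign.costMatrix σ x v v' k)) →
        ∃ g ∈ DeepAlign.symmetryGroup d,
          DeepAlign.activationMatching σ x v v' = {g} ∧ DeepAlign.F θ v v' = {g} :=
  DeepAlign.exists_weights_F_eq_activationMatching d σ hσ K hK N x ε hε κ
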